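/- Let $n\ge 0$, let $S^n\subset\mathbb R^{n+1}$ be the unit sphere, and let $f\colon M\to\mathbb R^{n+1}$ be a smooth immersion of an $m$-dimensional smooth manifold with $f(M)\subseteq S^n$ (for instance the inclusion of a smooth submanifold $M\subseteq S^n$); $M$ carries the Riemannian metric induced by $f$. A screw line is a continuous rectifiable curve $r$ in $\mathbb R^{n+1}$, parametrized by arclength on an interval, such that the distance between $r(s)$ and $r(t)$ depends only on $t-s$. Suppose that all geodesics of $M$ are congruent screw lines in $\mathbb R^{n+1}$, that is: for every unit speed geodesic $\gamma$ of $M$ on an open interval, $f\circ\gamma$ is a screw line, and for any two unit speed geodesics $\gamma,\sigma$ of $M$ defined on the same open interval $J$ there is a rigid motion (isometry) $U$ of $\mathbb R^{n+1}$ with $f(\gamma(t))=U(f(\sigma(t)))$ for all $t\in J$. If the codimension $n+1-m$ of $M$ in $\mathbb R^{n+1}$ is $1$ or $2$, then $M$ has constant sectional curvature: there is a real number $\kappa$ such that every tangent plane of $M$ at every point has sectional curvature $\kappa$. -/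

import Mathlib

open scoped Manifold ContDiff

noncomputable section

namespace ScrewGeodesics

/-! ### Riemannian geometry in coordinates

`G` is the matrix of a Riemannian metric on an open part of `ℝᵐ`, as a function of the point. -/

/-- The partial derivative `∂ᵢ F` at `y`. -/
def partialDeriv {m : ℕ} (i : Fin m) (F : EuclideanSpace ℝ (Fin m) → ℝ)
    (y : EuclideanSpace ℝ (Fin m)) : ℝ :=
  fderiv ℝ F y (EuclideanSpace.single i (1 : ℝ))

/-- The Christoffel symbol `Γᵏᵢⱼ = ½ ∑ₗ gᵏˡ (∂ᵢ gⱼₗ + ∂ⱼ gᵢₗ - ∂ₗ gᵢⱼ)` of the Levi-Civita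
connection of `G`. -/
def christoffel {m : ℕ} (G : EuclideanSpace ℝ (Fin m) → Matrix (Fin m) (Fin m) ℝ)
    (k i j : Fin m) (y : EuclideanSpace ℝ (Fin m)) : ℝ :=
  (1 / 2 : ℝ) * ∑ l, (G y)⁻¹ k l *
    (partialDeriv i (fun z => G z j l) y + partialDeriv j (fun z => G z i l) y
      - partialDeriv l (fun z => G z i j) y)

/-- The component along `∂ₗ` of `R(∂ᵢ, ∂ⱼ) ∂ₖ`, where
`R(X, Y) Z = ∇_X ∇_Y Z - ∇_Y ∇_X Z - ∇_[X, Y] Z` is the Riemann curvature tensor of `G`. -/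
def riemannTensor {m : ℕ} (G : EuclideanSpace ℝ (Fin m) → Matrix (Fin m) (Fin m) ℝ)
    (l k i j : Fin m) (y : EuclideanSpace ℝ (Fin m)) : ℝ :=
  partialDeriv i (christoffel G l j k) y - partialDeriv j (christoffel G l i k) y
    + ∑ h, (christoffel G h j k y * christoffel G l i h y
      - christoffel G h i k y * christoffel G l j h y)

/-- The inner product of the coordinate vectors `v` and `w` at `y`. -/
def metricInner {m : ℕ} (G : EuclideanSpace ℝ (Fin m) → Matrix (Fin m) (Fin m) ℝ)
    (y v w : EuclideanSpace ℝ (Fin m)) : ℝ :=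
  ∑ i, ∑ j, G y i j * v i * w j

/-- The sectional curvature `⟨R(v, w) w, v⟩ / (|v|² |w|² - ⟨v, w⟩²)` of the plane spanned by the
coordinate vectors `v` and `w` at `y`. -/
def coordSectionalCurvature {m : ℕ}
    (G : EuclideanSpace ℝ (Fin m) → Matrix (Fin m) (Fin m) ℝ)
    (y v w : EuclideanSpace ℝ (Fin m)) : ℝ :=
  (∑ a, ∑ l, ∑ k, ∑ i, ∑ j, G y a l * riemannTensor G l k i j y * v i * w j * w k * v a) /
    (metricInner G y v v * metricInner G y w w - metricInner G y v w ^ 2)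

/-! ### Immersed submanifolds of Euclidean space -/

variable (m : ℕ) {N : ℕ} {M : Type*} [TopologicalSpace M] [ChartedSpace (EuclideanSpace ℝ (Fin m)) M]

/-- `f` is a smooth immersion: it is smooth and its differential is injective at every point. -/
def IsSmoothImmersion (f : M → EuclideanSpace ℝ (Fin N)) : Prop :=
  ContMDiff (𝓡 m) 𝓘(ℝ, EuclideanSpace ℝ (Fin N)) ∞ f ∧
    ∀ p : M, Function.Injective (mfderiv (𝓡 m) 𝓘(ℝ, EuclideanSpace ℝ (Fin N)) f p)

/-- The metric induced on `M` by `f : M → ℝᴺ` (the first fundamental form), written in the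
preferred chart at `p`: `gᵢⱼ = ⟨∂ᵢ φ, ∂ⱼ φ⟩`, where `φ` is `f` composed with the inverse of the
chart. -/
def inducedMetric (f : M → EuclideanSpace ℝ (Fin N)) (p : M)
    (y : EuclideanSpace ℝ (Fin m)) : Matrix (Fin m) (Fin m) ℝ :=
  Matrix.of fun i j =>
    inner ℝ
      (fderiv ℝ (f ∘ (extChartAt (𝓡 m) p).symm) y (EuclideanSpace.single i (1 : ℝ)))
      (fderiv ℝ (f ∘ (extChartAt (𝓡 m) p).symm) y (EuclideanSpace.single j (1 : ℝ)))

/-- The sectional curvature of the metric induced by `f`, for the plane in the tangent space of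
`M` at `p` that is spanned by `v` and `w`. The tangent space at `p` is the model space `ℝᵐ`, the
identification being given by the preferred chart at `p`. -/
def sectionalCurvature (f : M → EuclideanSpace ℝ (Fin N)) (p : M)
    (v w : TangentSpace (𝓡 m) p) : ℝ :=
  coordSectionalCurvature (inducedMetric m f p) (extChartAt (𝓡 m) p p) v w

/-- The induced metric has constant sectional curvature: one number is the sectional curvature of
every tangent plane at every point. -/
def HasConstantSectionalCurvature (f : M → EuclideanSpace ℝ (Fin N)) : Prop :=
  ∃ κ : ℝ, ∀ (p : M) (v w : TangentSpace (𝓡 m) p),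
    LinearIndependent ℝ ![v, w] → sectionalCurvature m f p v w = κ

/-- `γ` is, on the open interval `J`, a geodesic of the induced metric with unit speed: it is `C²`,
satisfies the geodesic equation `xₖ'' + ∑ᵢⱼ Γᵏᵢⱼ xᵢ' xⱼ' = 0` at each time `t`, where `x` denotes `γ`
read in the preferred chart at `γ t`, and its velocity has length one. -/
structure IsUnitSpeedGeodesicOn (f : M → EuclideanSpace ℝ (Fin N)) (γ : ℝ → M)
    (J : Set ℝ) : Prop where
  contMDiffOn : ContMDiffOn 𝓘(ℝ, ℝ) (𝓡 m) 2 γ J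
  geodesic_eq : ∀ t ∈ J, ∀ k : Fin m,
    deriv (deriv fun s => extChartAt (𝓡 m) (γ t) (γ s) k) t
      + ∑ i, ∑ j, christoffel (inducedMetric m f (γ t)) k i j (extChartAt (𝓡 m) (γ t) (γ t))
        * deriv (fun s => extChartAt (𝓡 m) (γ t) (γ s) i) t
        * deriv (fun s => extChartAt (𝓡 m) (γ t) (γ s) j) t = 0
  unit_speed : ∀ t ∈ J, ‖deriv (f ∘ γ) t‖ = 1

/-! ### Screw lines -/

/-- A screw line on `J`: a continuous rectifiable curve, parametrized by arclength, for which the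
distance of the points with parameters `s` and `t` depends only on `t - s`. -/
structure IsScrewLineOn {E : Type*} [PseudoMetricSpace E] (r : ℝ → E) (J : Set ℝ) : Prop where
  continuousOn : ContinuousOn r J
  hasUnitSpeedOn : HasUnitSpeedOn r J
  dist_eq : ∀ s ∈ J, ∀ t ∈ J, ∀ s' ∈ J, ∀ t' ∈ J,
    t - s = t' - s' → dist (r t) (r s) = dist (r t') (r s')

/-- Two curves in `ℝᴺ` are congruent on `J`: a rigid motion carries the one into the other. -/
def CongruentOn (r q : ℝ → EuclideanSpace ℝ (Fin N)) (J : Set ℝ) : Prop :=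
  ∃ U : EuclideanSpace ℝ (Fin N) ≃ᵃⁱ[ℝ] EuclideanSpace ℝ (Fin N), ∀ t ∈ J, r t = U (q t)

/-- All geodesics of the immersed submanifold are congruent screw lines in `ℝᴺ`: each unit speed
geodesic, on any open interval, is a screw line, and any two unit speed geodesics that are defined
on the same open interval are congruent. -/
def AllGeodesicsCongruentScrewLines (f : M → EuclideanSpace ℝ (Fin N)) : Prop :=
  (∀ (J : Set ℝ) (γ : ℝ → M), IsOpen J → J.OrdConnected →
    IsUnitSpeedGeodesicOn m f γ J → IsScrewLineOn (f ∘ γ) J) ∧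
  ∀ (J : Set ℝ) (γ σ : ℝ → M), IsOpen J → J.OrdConnected →
    IsUnitSpeedGeodesicOn m f γ J → IsUnitSpeedGeodesicOn m f σ J → CongruentOn (f ∘ γ) (f ∘ σ) J

end ScrewGeodesics

end

/-! Let `α` be the second fundamental form of `M` in Euclidean space. Along a geodesic the ambient
acceleration is purely normal and equals `α(v, v)`, with `v` the velocity. Rigid motions preserve
the length of the acceleration and a geodesic starts in every unit direction, so congruence of
geodesics makes `‖α(v, v)‖² = κ` for all unit `v` at all points
(`exists_norm_secondFundamentalForm_eq`).

Since `f(M)` lies in the sphere, `α(v, w) = β(v, w) - ⟨v, w⟩ f`, where `β` is normal to `M` and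
tangent to the sphere; hence `‖β(v, v)‖² = (κ - 1) |v|⁴`. The codimension in the sphere is at most
one, so the values of `β` lie on a line. Polarization then yields `⟨β(v, v), β(w, w)⟩ - ‖β(v, w)‖² =
(κ - 1)(|v|²|w|² - ⟨v, w⟩²)` (`inner_sub_norm_sq_of_norm_sq_quadratic`). By the Gauss equation
(`gauss_equation`) the sectional curvature is `(κ - 1) + 1 = κ`. -/

noncomputable section

namespace ScrewGeodesics

/-! ### Local theory of immersions -/

section Local

variable {m : ℕ} {F : Type*} [NormedAddCommGroup F] [InnerProductSpace ℝ F]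

/-- The partial derivative `∂ᵢ φ` of a vector valued function. -/
def vecPartialDeriv (i : Fin m) (φ : EuclideanSpace ℝ (Fin m) → F)
    (y : EuclideanSpace ℝ (Fin m)) : F :=
  fderiv ℝ φ y (EuclideanSpace.single i (1 : ℝ))

/-- The first fundamental form of `φ`. -/
def firstFundamentalForm (φ : EuclideanSpace ℝ (Fin m) → F) (y : EuclideanSpace ℝ (Fin m)) :
    Matrix (Fin m) (Fin m) ℝ :=
  Matrix.of fun i j => inner ℝ (vecPartialDeriv i φ y) (vecPartialDeriv j φ y)

/-- `φ` is a smooth immersion of the open set `U`. -/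
structure IsImmersionOn (φ : EuclideanSpace ℝ (Fin m) → F)
    (U : Set (EuclideanSpace ℝ (Fin m))) : Prop where
  isOpen : IsOpen U
  contDiffAt : ∀ y ∈ U, ContDiffAt ℝ ∞ φ y
  injective : ∀ y ∈ U, Function.Injective (fderiv ℝ φ y)

theorem vecPartialDeriv_contDiffAt {φ : EuclideanSpace ℝ (Fin m) → F}
    {y : EuclideanSpace ℝ (Fin m)} (h : ContDiffAt ℝ ∞ φ y) (i : Fin m) :
    ContDiffAt ℝ ∞ (vecPartialDeriv i φ) y :=
  (h.fderiv_right (m := ∞) (by simp)).clm_apply contDiffAt_const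

theorem partialDeriv_contDiffAt {φ : EuclideanSpace ℝ (Fin m) → ℝ}
    {y : EuclideanSpace ℝ (Fin m)} (h : ContDiffAt ℝ ∞ φ y) (i : Fin m) :
    ContDiffAt ℝ ∞ (partialDeriv i φ) y :=
  vecPartialDeriv_contDiffAt h i

theorem vecPartialDeriv_eq_fderiv_fderiv {φ : EuclideanSpace ℝ (Fin m) → F}
    {y : EuclideanSpace ℝ (Fin m)} (h : ContDiffAt ℝ ∞ φ y) (i j : Fin m) :
    vecPartialDeriv i (vecPartialDeriv j φ) y =
      fderiv ℝ (fderiv ℝ φ) y (EuclideanSpace.single i 1) (EuclideanSpace.single j 1) := by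
  have h1 : DifferentiableAt ℝ (fderiv ℝ φ) y :=
    (h.fderiv_right (m := ∞) (by simp)).differentiableAt (by simp)
  unfold vecPartialDeriv
  rw [fderiv_clm_apply h1 (differentiableAt_const _)]
  simp

theorem vecPartialDeriv_comm {φ : EuclideanSpace ℝ (Fin m) → F}
    {y : EuclideanSpace ℝ (Fin m)} (h : ContDiffAt ℝ ∞ φ y) (i j : Fin m) :
    vecPartialDeriv i (vecPartialDeriv j φ) y = vecPartialDeriv j (vecPartialDeriv i φ) y := by
  rw [vecPartialDeriv_eq_fderiv_fderiv h, vecPartialDeriv_eq_fderiv_fderiv h]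
  exact (h.isSymmSndFDerivAt (by simpa using ENat.LEInfty.out)).eq _ _

theorem partialDeriv_inner {u w : EuclideanSpace ℝ (Fin m) → F} {y : EuclideanSpace ℝ (Fin m)}
    (hu : ContDiffAt ℝ ∞ u y) (hw : ContDiffAt ℝ ∞ w y) (i : Fin m) :
    partialDeriv i (fun z => inner ℝ (u z) (w z)) y =
      inner ℝ (u y) (vecPartialDeriv i w y) + inner ℝ (vecPartialDeriv i u y) (w y) := by
  unfold partialDeriv vecPartialDeriv
  rw [fderiv_inner_apply ℝ (hu.differentiableAt (by simp)) (hw.differentiableAt (by simp))]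

theorem euclidean_eq_sum_single (v : EuclideanSpace ℝ (Fin m)) :
    v = ∑ i, v i • EuclideanSpace.single i (1 : ℝ) := by
  ext j
  simp [Finset.sum_apply, Pi.single_apply]

theorem fderiv_eq_sum_vecPartialDeriv (φ : EuclideanSpace ℝ (Fin m) → F)
    (y v : EuclideanSpace ℝ (Fin m)) :
    fderiv ℝ φ y v = ∑ i, v i • vecPartialDeriv i φ y := by
  conv_lhs => rw [euclidean_eq_sum_single v]
  simp [vecPartialDeriv]

theorem metricInner_firstFundamentalForm (φ : EuclideanSpace ℝ (Fin m) → F)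
    (y v w : EuclideanSpace ℝ (Fin m)) :
    metricInner (firstFundamentalForm φ) y v w = inner ℝ (fderiv ℝ φ y v) (fderiv ℝ φ y w) := by
  rw [fderiv_eq_sum_vecPartialDeriv, fderiv_eq_sum_vecPartialDeriv, sum_inner]
  simp only [metricInner, firstFundamentalForm, Matrix.of_apply, inner_sum, inner_smul_left,
    inner_smul_right, conj_trivial]
  refine Finset.sum_congr rfl fun i _ => Finset.sum_congr rfl fun j _ => by ring

theorem contDiffAt_det {ι E : Type*} [Fintype ι] [DecidableEq ι] [NormedAddCommGroup E]
    [NormedSpace ℝ E] {A : E → Matrix ι ι ℝ} {y : E}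
    (h : ∀ i j, ContDiffAt ℝ ∞ (fun z => A z i j) y) :
    ContDiffAt ℝ ∞ (fun z => (A z).det) y := by
  simp only [Matrix.det_apply']
  refine ContDiffAt.sum fun σ _ => contDiffAt_const.mul ?_
  exact contDiffAt_prod fun i _ => h _ _

/-- Cramer's rule: an entry of the adjugate is the determinant of a matrix with one row replaced by
a constant one. -/
theorem contDiffAt_inv_apply {ι E : Type*} [Fintype ι] [DecidableEq ι] [NormedAddCommGroup E]
    [NormedSpace ℝ E] {A : E → Matrix ι ι ℝ} {y : E}
    (h : ∀ i j, ContDiffAt ℝ ∞ (fun z => A z i j) y) (hdet : (A y).det ≠ 0) (i j : ι) :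
    ContDiffAt ℝ ∞ (fun z => (A z)⁻¹ i j) y := by
  simp only [Matrix.inv_def, Matrix.smul_apply, Ring.inverse_eq_inv', smul_eq_mul,
    Matrix.adjugate_apply]
  refine ((contDiffAt_det h).inv hdet).mul (contDiffAt_det fun a b => ?_)
  by_cases hab : a = j
  · subst hab
    simpa using contDiffAt_const
  · simpa [Matrix.updateRow_ne hab] using h a b

namespace IsImmersionOn

variable {φ : EuclideanSpace ℝ (Fin m) → F} {U : Set (EuclideanSpace ℝ (Fin m))}

theorem contDiffAt_vecPartialDeriv (h : IsImmersionOn φ U) {y} (hy : y ∈ U) (i : Fin m) :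
    ContDiffAt ℝ ∞ (vecPartialDeriv i φ) y :=
  vecPartialDeriv_contDiffAt (h.contDiffAt y hy) i

theorem contDiffAt_firstFundamentalForm (h : IsImmersionOn φ U) {y} (hy : y ∈ U) (i j : Fin m) :
    ContDiffAt ℝ ∞ (fun z => firstFundamentalForm φ z i j) y :=
  (h.contDiffAt_vecPartialDeriv hy i).inner ℝ (h.contDiffAt_vecPartialDeriv hy j)

theorem partialDeriv_firstFundamentalForm (h : IsImmersionOn φ U) {y} (hy : y ∈ U)
    (i a b : Fin m) :
    partialDeriv i (fun z => firstFundamentalForm φ z a b) y =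
      inner ℝ (vecPartialDeriv a φ y) (vecPartialDeriv i (vecPartialDeriv b φ) y)
        + inner ℝ (vecPartialDeriv i (vecPartialDeriv a φ) y) (vecPartialDeriv b φ y) :=
  partialDeriv_inner (h.contDiffAt_vecPartialDeriv hy a) (h.contDiffAt_vecPartialDeriv hy b) i

/-- A kernel vector of the Gram matrix is mapped by the differential to a vector of length zero. -/
theorem det_ne_zero (h : IsImmersionOn φ U) {y} (hy : y ∈ U) :
    (firstFundamentalForm φ y).det ≠ 0 := by
  intro h0
  obtain ⟨v, hv, hGv⟩ := Matrix.exists_mulVec_eq_zero_iff.mpr h0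
  have h1 : metricInner (firstFundamentalForm φ) y (WithLp.toLp 2 v) (WithLp.toLp 2 v) = 0 := by
    have h2 : v ⬝ᵥ (firstFundamentalForm φ y).mulVec v = 0 := by rw [hGv]; simp
    rw [← h2]
    simp only [metricInner, dotProduct, Matrix.mulVec, Finset.mul_sum]
    exact Finset.sum_congr rfl fun i _ => Finset.sum_congr rfl fun j _ => by ring
  rw [metricInner_firstFundamentalForm, inner_self_eq_zero] at h1
  have h3 := h.injective y hy (h1.trans (map_zero _).symm)
  exact hv (by simpa using congrArg WithLp.ofLp h3)

theorem contDiffAt_christoffel (h : IsImmersionOn φ U) {y} (hy : y ∈ U) (k i j : Fin m) :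
    ContDiffAt ℝ ∞ (christoffel (firstFundamentalForm φ) k i j) y := by
  unfold christoffel
  refine contDiffAt_const.mul (ContDiffAt.sum fun l _ => ?_)
  refine (contDiffAt_inv_apply (h.contDiffAt_firstFundamentalForm hy) (h.det_ne_zero hy) k l).mul ?_
  exact ((partialDeriv_contDiffAt (h.contDiffAt_firstFundamentalForm hy _ _) _).add
    (partialDeriv_contDiffAt (h.contDiffAt_firstFundamentalForm hy _ _) _)).sub
    (partialDeriv_contDiffAt (h.contDiffAt_firstFundamentalForm hy _ _) _)

/-- Lowering the index of the Christoffel symbols. -/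
theorem sum_mul_christoffel (h : IsImmersionOn φ U) {y} (hy : y ∈ U) (a i j : Fin m) :
    ∑ k, firstFundamentalForm φ y a k * christoffel (firstFundamentalForm φ) k i j y =
      inner ℝ (vecPartialDeriv i (vecPartialDeriv j φ) y) (vecPartialDeriv a φ y) := by
  set G := firstFundamentalForm φ y with hG
  set B : Fin m → ℝ := fun l =>
    inner ℝ (vecPartialDeriv i (vecPartialDeriv j φ) y) (vecPartialDeriv l φ y) with hB
  -- The three metric derivatives expand into six inner products; by symmetry of second derivatives
  -- four cancel and the other two are both `B l`.
  have hΓ : ∀ k, christoffel (firstFundamentalForm φ) k i j y = (G⁻¹.mulVec B) k := by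
    intro k
    simp only [christoffel, Matrix.mulVec, dotProduct, Finset.mul_sum]
    refine Finset.sum_congr rfl fun l _ => ?_
    rw [h.partialDeriv_firstFundamentalForm hy, h.partialDeriv_firstFundamentalForm hy,
      h.partialDeriv_firstFundamentalForm hy, vecPartialDeriv_comm (h.contDiffAt y hy) l i,
      vecPartialDeriv_comm (h.contDiffAt y hy) l j, vecPartialDeriv_comm (h.contDiffAt y hy) j i,
      real_inner_comm (vecPartialDeriv i (vecPartialDeriv l φ) y),
      real_inner_comm (vecPartialDeriv j (vecPartialDeriv l φ) y)]
    simp only [hB, hG]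
    ring
  have hdet : IsUnit G.det := isUnit_iff_ne_zero.mpr (h.det_ne_zero hy)
  calc _ = (G.mulVec (G⁻¹.mulVec B)) a := by simp only [hΓ]; rfl
    _ = _ := by rw [Matrix.mulVec_mulVec, Matrix.mul_nonsing_inv _ hdet, Matrix.one_mulVec]

end IsImmersionOn

/-- The second fundamental form `α(∂ᵢ, ∂ⱼ) = ∂ᵢ∂ⱼφ - ∑ₗ Γˡᵢⱼ ∂ₗφ` in coordinates. -/
def secondFundamentalCoeff (φ : EuclideanSpace ℝ (Fin m) → F) (i j : Fin m)
    (y : EuclideanSpace ℝ (Fin m)) : F :=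
  vecPartialDeriv i (vecPartialDeriv j φ) y
    - ∑ l, christoffel (firstFundamentalForm φ) l i j y • vecPartialDeriv l φ y

/-- The second fundamental form as a bilinear map. -/
def secondFundamentalForm (φ : EuclideanSpace ℝ (Fin m) → F)
    (y v w : EuclideanSpace ℝ (Fin m)) : F :=
  ∑ i, ∑ j, (v i * w j) • secondFundamentalCoeff φ i j y

namespace IsImmersionOn

variable {φ : EuclideanSpace ℝ (Fin m) → F} {U : Set (EuclideanSpace ℝ (Fin m))}

/-- The lowered Christoffel symbols are the products of `∂ᵢ∂ⱼφ` with the tangent basis, so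
subtracting `∑ₗ Γˡᵢⱼ ∂ₗφ` removes exactly the tangential part. -/
theorem inner_secondFundamentalCoeff (h : IsImmersionOn φ U) {y} (hy : y ∈ U) (i j a : Fin m) :
    inner ℝ (secondFundamentalCoeff φ i j y) (vecPartialDeriv a φ y) = 0 := by
  rw [secondFundamentalCoeff, inner_sub_left, ← h.sum_mul_christoffel hy, sum_inner, sub_eq_zero]
  refine Finset.sum_congr rfl fun l _ => ?_
  rw [inner_smul_left, real_inner_comm]
  simp [firstFundamentalForm, mul_comm]

theorem _root_.ScrewGeodesics.christoffel_firstFundamentalForm_comm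
    (φ : EuclideanSpace ℝ (Fin m) → F) (y : EuclideanSpace ℝ (Fin m)) (k i j : Fin m) :
    christoffel (firstFundamentalForm φ) k i j y = christoffel (firstFundamentalForm φ) k j i y := by
  have hs : ∀ z, firstFundamentalForm φ z j i = firstFundamentalForm φ z i j := fun z =>
    real_inner_comm _ _
  simp only [christoffel, hs]
  congr 1
  exact Finset.sum_congr rfl fun l _ => by ring

theorem secondFundamentalCoeff_comm (h : IsImmersionOn φ U) {y} (hy : y ∈ U) (i j : Fin m) :
    secondFundamentalCoeff φ i j y = secondFundamentalCoeff φ j i y := by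
  simp only [secondFundamentalCoeff, vecPartialDeriv_comm (h.contDiffAt y hy) i j,
    christoffel_firstFundamentalForm_comm φ y _ i j]

/-- Differentiating the lowered-index identity by the product rule avoids differentiating the
inverse metric. -/
theorem sum_mul_partialDeriv_christoffel (h : IsImmersionOn φ U) {y} (hy : y ∈ U)
    (a i j k : Fin m) :
    ∑ l, firstFundamentalForm φ y a l *
        partialDeriv i (christoffel (firstFundamentalForm φ) l j k) y =
      inner ℝ (vecPartialDeriv j (vecPartialDeriv k φ) y)
          (vecPartialDeriv i (vecPartialDeriv a φ) y)
        + inner ℝ (vecPartialDeriv i (vecPartialDeriv j (vecPartialDeriv k φ)) y)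
          (vecPartialDeriv a φ y)
        - ∑ l, partialDeriv i (fun z => firstFundamentalForm φ z a l) y
          * christoffel (firstFundamentalForm φ) l j k y := by
  have hev : (fun z => ∑ l, firstFundamentalForm φ z a l *
      christoffel (firstFundamentalForm φ) l j k z) =ᶠ[nhds y] fun z =>
      inner ℝ (vecPartialDeriv j (vecPartialDeriv k φ) z) (vecPartialDeriv a φ z) := by
    filter_upwards [h.isOpen.mem_nhds hy] with z hz
    exact h.sum_mul_christoffel hz a j k
  have h1 := partialDeriv_inner (vecPartialDeriv_contDiffAt (h.contDiffAt_vecPartialDeriv hy k) j)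
    (h.contDiffAt_vecPartialDeriv hy a) i
  have hG := fun l => (h.contDiffAt_firstFundamentalForm hy a l).differentiableAt (by simp)
  have hΓ := fun l => (h.contDiffAt_christoffel hy l j k).differentiableAt (by simp)
  unfold partialDeriv at h1 ⊢
  rw [← h1, ← hev.fderiv_eq, fderiv_fun_sum fun l _ => (hG l).fun_mul (hΓ l), eq_sub_iff_add_eq,
    ← Finset.sum_add_distrib, sum_apply]
  refine Finset.sum_congr rfl fun l _ => ?_
  rw [fderiv_fun_mul (hG l) (hΓ l)]
  simp [mul_comm]

/-- The first factor is normal, so the tangential correction in the second drops out. This is the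
shape in which the terms of the Gauss equation appear. -/
theorem inner_secondFundamentalCoeff_left (h : IsImmersionOn φ U) {y} (hy : y ∈ U)
    (i j a b : Fin m) :
    inner ℝ (secondFundamentalCoeff φ i j y) (secondFundamentalCoeff φ a b y) =
      inner ℝ (vecPartialDeriv i (vecPartialDeriv j φ) y)
          (vecPartialDeriv a (vecPartialDeriv b φ) y)
        - ∑ l, christoffel (firstFundamentalForm φ) l i j y
          * inner ℝ (vecPartialDeriv l φ y) (vecPartialDeriv a (vecPartialDeriv b φ) y) := by
  conv_lhs => rw [secondFundamentalCoeff.eq_def φ a b]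
  rw [inner_sub_right, inner_sum]
  simp only [inner_smul_right, h.inner_secondFundamentalCoeff hy, mul_zero, Finset.sum_const_zero,
    sub_zero]
  rw [secondFundamentalCoeff, inner_sub_left, sum_inner]
  simp [inner_smul_left]

/-- The Gauss equation in coordinates. -/
theorem gauss_equation (h : IsImmersionOn φ U) {y} (hy : y ∈ U) (a k i j : Fin m) :
    ∑ l, firstFundamentalForm φ y a l * riemannTensor (firstFundamentalForm φ) l k i j y =
      inner ℝ (secondFundamentalCoeff φ j k y) (secondFundamentalCoeff φ i a y)
        - inner ℝ (secondFundamentalCoeff φ i k y) (secondFundamentalCoeff φ j a y) := by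
  have hthird : vecPartialDeriv i (vecPartialDeriv j (vecPartialDeriv k φ)) y =
      vecPartialDeriv j (vecPartialDeriv i (vecPartialDeriv k φ)) y :=
    vecPartialDeriv_comm (h.contDiffAt_vecPartialDeriv hy k) i j
  have hquad : ∀ i j : Fin m, ∑ l, firstFundamentalForm φ y a l *
      ∑ q, christoffel (firstFundamentalForm φ) q j k y *
        christoffel (firstFundamentalForm φ) l i q y =
      ∑ q, christoffel (firstFundamentalForm φ) q j k y *
        inner ℝ (vecPartialDeriv i (vecPartialDeriv q φ) y) (vecPartialDeriv a φ y) := by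
    intro i j
    simp only [Finset.mul_sum, ← h.sum_mul_christoffel hy]
    rw [Finset.sum_comm]
    exact Finset.sum_congr rfl fun _ _ => Finset.sum_congr rfl fun _ _ => by ring
  -- The first sum cancels the quadratic Christoffel term of `hquad`; the second is the tangential
  -- correction that turns `⟨∂ⱼ∂ₖφ, ∂ᵢ∂ₐφ⟩` into a product of second fundamental forms.
  have hsplit : ∀ i j : Fin m,
      ∑ l, partialDeriv i (fun z => firstFundamentalForm φ z a l) y
          * christoffel (firstFundamentalForm φ) l j k y =
      ∑ l, christoffel (firstFundamentalForm φ) l j k y *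
        inner ℝ (vecPartialDeriv i (vecPartialDeriv l φ) y) (vecPartialDeriv a φ y)
      + ∑ l, christoffel (firstFundamentalForm φ) l j k y
          * inner ℝ (vecPartialDeriv l φ y) (vecPartialDeriv i (vecPartialDeriv a φ) y) := by
    intro i j
    rw [← Finset.sum_add_distrib]
    refine Finset.sum_congr rfl fun l _ => ?_
    rw [h.partialDeriv_firstFundamentalForm hy, real_inner_comm (vecPartialDeriv a φ y),
      real_inner_comm (vecPartialDeriv l φ y)]
    ring
  calc _ = (∑ l, firstFundamentalForm φ y a l *
          partialDeriv i (christoffel (firstFundamentalForm φ) l j k) y)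
        - (∑ l, firstFundamentalForm φ y a l *
          partialDeriv j (christoffel (firstFundamentalForm φ) l i k) y)
        + (∑ l, firstFundamentalForm φ y a l *
          ∑ q, christoffel (firstFundamentalForm φ) q j k y *
            christoffel (firstFundamentalForm φ) l i q y)
        - ∑ l, firstFundamentalForm φ y a l *
          ∑ q, christoffel (firstFundamentalForm φ) q i k y *
            christoffel (firstFundamentalForm φ) l j q y := by
        rw [← Finset.sum_sub_distrib, ← Finset.sum_add_distrib, ← Finset.sum_sub_distrib]
        refine Finset.sum_congr rfl fun l _ => ?_
        rw [riemannTensor, Finset.sum_sub_distrib]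
        ring
    _ = _ := by
        rw [hquad i j, hquad j i, h.sum_mul_partialDeriv_christoffel hy,
          h.sum_mul_partialDeriv_christoffel hy, hsplit i j, hsplit j i,
          h.inner_secondFundamentalCoeff_left hy, h.inner_secondFundamentalCoeff_left hy, hthird]
        ring

theorem inner_secondFundamentalForm_fderiv (h : IsImmersionOn φ U) {y} (hy : y ∈ U)
    (v w u : EuclideanSpace ℝ (Fin m)) :
    inner ℝ (secondFundamentalForm φ y v w) (fderiv ℝ φ y u) = 0 := by
  rw [fderiv_eq_sum_vecPartialDeriv, secondFundamentalForm]
  simp [sum_inner, inner_sum, inner_smul_left, inner_smul_right, h.inner_secondFundamentalCoeff hy]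

theorem secondFundamentalForm_comm (h : IsImmersionOn φ U) {y} (hy : y ∈ U)
    (v w : EuclideanSpace ℝ (Fin m)) :
    secondFundamentalForm φ y v w = secondFundamentalForm φ y w v := by
  unfold secondFundamentalForm
  rw [Finset.sum_comm]
  refine Finset.sum_congr rfl fun i _ => Finset.sum_congr rfl fun j _ => ?_
  rw [h.secondFundamentalCoeff_comm hy, mul_comm]

/-- The Gauss equation for the sectional curvature. -/
theorem coordSectionalCurvature_eq (h : IsImmersionOn φ U) {y} (hy : y ∈ U)
    (v w : EuclideanSpace ℝ (Fin m)) :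
    coordSectionalCurvature (firstFundamentalForm φ) y v w =
      (inner ℝ (secondFundamentalForm φ y v v) (secondFundamentalForm φ y w w)
        - ‖secondFundamentalForm φ y v w‖ ^ 2) /
      (‖fderiv ℝ φ y v‖ ^ 2 * ‖fderiv ℝ φ y w‖ ^ 2
        - inner ℝ (fderiv ℝ φ y v) (fderiv ℝ φ y w) ^ 2) := by
  simp only [coordSectionalCurvature, metricInner_firstFundamentalForm,
    real_inner_self_eq_norm_sq]
  congr 1
  have hform : ∀ a b c d : EuclideanSpace ℝ (Fin m),
      inner ℝ (secondFundamentalForm φ y a b) (secondFundamentalForm φ y c d) =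
      ∑ r, ∑ s, ∑ p, ∑ q, a p * b q * c r * d s *
        inner ℝ (secondFundamentalCoeff φ p q y) (secondFundamentalCoeff φ r s y) := by
    intro a b c d
    simp only [secondFundamentalForm, sum_inner, inner_sum, inner_smul_left, inner_smul_right,
      conj_trivial, Finset.mul_sum]
    refine Finset.sum_congr rfl fun _ _ => Finset.sum_congr rfl fun _ _ =>
      Finset.sum_congr rfl fun _ _ => Finset.sum_congr rfl fun _ _ => by ring
  have hL : ∀ a, (∑ l, ∑ k, ∑ i, ∑ j, firstFundamentalForm φ y a l *
      riemannTensor (firstFundamentalForm φ) l k i j y * v i * w j * w k * v a) =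
      ∑ k, ∑ i, ∑ j, v i * w j * w k * v a *
        (inner ℝ (secondFundamentalCoeff φ j k y) (secondFundamentalCoeff φ i a y)
        - inner ℝ (secondFundamentalCoeff φ i k y) (secondFundamentalCoeff φ j a y)) := by
    intro a
    rw [Finset.sum_comm]
    refine Finset.sum_congr rfl fun k _ => ?_
    rw [Finset.sum_comm]
    refine Finset.sum_congr rfl fun i _ => ?_
    rw [Finset.sum_comm]
    refine Finset.sum_congr rfl fun j _ => ?_
    rw [← h.gauss_equation hy, Finset.mul_sum]
    exact Finset.sum_congr rfl fun l _ => by ring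
  simp only [hL, mul_sub, Finset.sum_sub_distrib]
  congr 1
  · rw [real_inner_comm, hform]
    refine Finset.sum_congr rfl fun a _ => ?_
    rw [Finset.sum_comm]
    refine Finset.sum_congr rfl fun i _ => ?_
    rw [Finset.sum_comm]
    refine Finset.sum_congr rfl fun j _ => Finset.sum_congr rfl fun k _ => ?_
    rw [h.secondFundamentalCoeff_comm hy i a]
    ring
  · rw [← real_inner_self_eq_norm_sq, hform]
    refine Finset.sum_congr rfl fun a _ => ?_
    rw [Finset.sum_comm_cycle]
    refine Finset.sum_congr rfl fun j _ => ?_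
    rw [Finset.sum_comm]
    refine Finset.sum_congr rfl fun i _ => Finset.sum_congr rfl fun k _ => ?_
    rw [h.secondFundamentalCoeff_comm hy j a]
    ring

end IsImmersionOn

end Local

/-! ### Acceleration of curves and geodesics in coordinates -/

section Curves

variable {m : ℕ} {F : Type*} [NormedAddCommGroup F] [InnerProductSpace ℝ F]

/-- The quadratic term `∑ᵢⱼ Γᵏᵢⱼ uᵢ uⱼ` of the geodesic equation. -/
def christoffelQuadratic (G : EuclideanSpace ℝ (Fin m) → Matrix (Fin m) (Fin m) ℝ)
    (y u : EuclideanSpace ℝ (Fin m)) : EuclideanSpace ℝ (Fin m) :=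
  WithLp.toLp 2 fun k => ∑ i, ∑ j, christoffel G k i j y * u i * u j

/-- Splits the second derivative into normal and tangential parts; the tangential part is the
quadratic term of the geodesic equation. -/
theorem ContDiffAt.fderiv_fderiv_apply {φ : EuclideanSpace ℝ (Fin m) → F}
    {y : EuclideanSpace ℝ (Fin m)} (h : ContDiffAt ℝ ∞ φ y) (u : EuclideanSpace ℝ (Fin m)) :
    fderiv ℝ (fderiv ℝ φ) y u u =
      secondFundamentalForm φ y u u
        + fderiv ℝ φ y (christoffelQuadratic (firstFundamentalForm φ) y u) := by
  have h1 : fderiv ℝ (fderiv ℝ φ) y u u =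
      ∑ i, ∑ j, (u i * u j) • vecPartialDeriv i (vecPartialDeriv j φ) y := by
    conv_lhs => rw [euclidean_eq_sum_single u]
    simp only [map_sum, map_smul, sum_apply, smul_apply, vecPartialDeriv_eq_fderiv_fderiv h,
      Finset.smul_sum, smul_smul]
    rw [Finset.sum_comm]
    exact Finset.sum_congr rfl fun _ _ => Finset.sum_congr rfl fun _ _ => by rw [mul_comm]
  have h2 : fderiv ℝ φ y (christoffelQuadratic (firstFundamentalForm φ) y u) =
      ∑ i, ∑ j, (u i * u j) •
        ∑ l, christoffel (firstFundamentalForm φ) l i j y • vecPartialDeriv l φ y := by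
    rw [fderiv_eq_sum_vecPartialDeriv]
    simp only [christoffelQuadratic, Finset.sum_smul, Finset.smul_sum, smul_smul]
    rw [Finset.sum_comm]
    refine Finset.sum_congr rfl fun i _ => ?_
    rw [Finset.sum_comm]
    exact Finset.sum_congr rfl fun j _ => Finset.sum_congr rfl fun l _ => by congr 1; ring
  rw [h1, h2, secondFundamentalForm, ← Finset.sum_add_distrib]
  refine Finset.sum_congr rfl fun i _ => ?_
  rw [← Finset.sum_add_distrib]
  refine Finset.sum_congr rfl fun j _ => ?_
  rw [secondFundamentalCoeff, ← smul_add, sub_add_cancel]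

namespace IsImmersionOn

variable {φ : EuclideanSpace ℝ (Fin m) → F} {U : Set (EuclideanSpace ℝ (Fin m))}
  {x u : ℝ → EuclideanSpace ℝ (Fin m)} {a : EuclideanSpace ℝ (Fin m)} {t : ℝ}

theorem hasDerivAt_comp (h : IsImmersionOn φ U) (hxU : x t ∈ U) (hx : HasDerivAt x (u t) t) :
    HasDerivAt (φ ∘ x) (fderiv ℝ φ (x t) (u t)) t :=
  ((h.contDiffAt _ hxU).differentiableAt (by simp)).hasFDerivAt.comp_hasDerivAt t hx

theorem hasDerivAt_fderiv_comp (h : IsImmersionOn φ U) (hxU : x t ∈ U)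
    (hx : HasDerivAt x (u t) t) (hu : HasDerivAt u a t) :
    HasDerivAt (fun s => fderiv ℝ φ (x s) (u s))
      (secondFundamentalForm φ (x t) (u t) (u t)
        + fderiv ℝ φ (x t) (a + christoffelQuadratic (firstFundamentalForm φ) (x t) (u t))) t := by
  have h1 : DifferentiableAt ℝ (fderiv ℝ φ) (x t) :=
    ((h.contDiffAt _ hxU).fderiv_right (m := ∞) (by simp)).differentiableAt (by simp)
  have h2 := (h1.hasFDerivAt.comp_hasDerivAt t hx).clm_apply hu
  refine h2.congr_deriv ?_
  rw [ContDiffAt.fderiv_fderiv_apply (h.contDiffAt _ hxU), map_add, Function.comp_apply]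
  abel

/-- The Gauss formula for the acceleration of a curve. -/
theorem deriv_deriv_comp (h : IsImmersionOn φ U) (hxU : x t ∈ U)
    (hx : ∀ᶠ s in nhds t, HasDerivAt x (u s) s) (hu : HasDerivAt u a t) :
    deriv (deriv (φ ∘ x)) t = secondFundamentalForm φ (x t) (u t) (u t)
        + fderiv ℝ φ (x t) (a + christoffelQuadratic (firstFundamentalForm φ) (x t) (u t)) := by
  have hev : deriv (φ ∘ x) =ᶠ[nhds t] fun s => fderiv ℝ φ (x s) (u s) := by
    filter_upwards [hx, hx.self_of_nhds.continuousAt.preimage_mem_nhds (h.isOpen.mem_nhds hxU)]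
      with s hs hsU
    exact (h.hasDerivAt_comp hsU hs).deriv
  rw [hev.deriv_eq, (h.hasDerivAt_fderiv_comp hxU hx.self_of_nhds hu).deriv]

theorem contDiffAt_christoffelQuadratic (h : IsImmersionOn φ U)
    {z : EuclideanSpace ℝ (Fin m) × EuclideanSpace ℝ (Fin m)} (hz : z.1 ∈ U) :
    ContDiffAt ℝ ∞ (fun z : EuclideanSpace ℝ (Fin m) × EuclideanSpace ℝ (Fin m) =>
      christoffelQuadratic (firstFundamentalForm φ) z.1 z.2) z := by
  rw [contDiffAt_euclidean]
  intro k
  have hc : ∀ i : Fin m, ContDiffAt ℝ ∞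
      (fun z : EuclideanSpace ℝ (Fin m) × EuclideanSpace ℝ (Fin m) => z.2 i) z := fun i =>
    (EuclideanSpace.proj (𝕜 := ℝ) i).contDiff.contDiffAt.comp z contDiffAt_snd
  change ContDiffAt ℝ ∞ (fun z : EuclideanSpace ℝ (Fin m) × EuclideanSpace ℝ (Fin m) =>
    ∑ i, ∑ j, christoffel (firstFundamentalForm φ) k i j z.1 * z.2 i * z.2 j) z
  refine ContDiffAt.sum fun i _ => ContDiffAt.sum fun j _ => ?_
  exact (((h.contDiffAt_christoffel hz k i j).comp z contDiffAt_fst).mul (hc i)).mul (hc j)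

/-- Local existence of geodesics in coordinates. -/
theorem exists_geodesic (h : IsImmersionOn φ U) {y : EuclideanSpace ℝ (Fin m)} (hy : y ∈ U)
    (v : EuclideanSpace ℝ (Fin m)) :
    ∃ ε > (0 : ℝ), ∃ x u : ℝ → EuclideanSpace ℝ (Fin m), x 0 = y ∧ u 0 = v ∧
      ∀ t ∈ Set.Ioo (-ε) ε, x t ∈ U ∧ HasDerivAt x (u t) t ∧
        HasDerivAt u (-christoffelQuadratic (firstFundamentalForm φ) (x t) (u t)) t := by
  -- The geodesic equation is a first-order autonomous system for `(x, u)` with a `C¹` vector field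
  -- near `(y, v)`, so Picard–Lindelöf applies; the interval is then shrunk to keep `x` in `U`.
  have hX : ContDiffAt ℝ 1 (fun z : EuclideanSpace ℝ (Fin m) × EuclideanSpace ℝ (Fin m) =>
      (z.2, -christoffelQuadratic (firstFundamentalForm φ) z.1 z.2)) (y, v) :=
    (contDiffAt_snd.prodMk (h.contDiffAt_christoffelQuadratic hy).neg).of_le (by simp)
  obtain ⟨α, hα0, ε, hε, hα⟩ :=
    hX.exists_forall_mem_closedBall_exists_eq_forall_mem_Ioo_hasDerivAt₀ 0
  simp only [zero_sub, zero_add] at hα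
  have hcont : ContinuousAt (fun t => (α t).1) 0 :=
    (hα 0 (by simpa using hε)).continuousAt.fst
  have hU : ∀ᶠ t in nhds (0 : ℝ), (α t).1 ∈ U :=
    hcont.preimage_mem_nhds (h.isOpen.mem_nhds (by simpa [hα0] using hy))
  obtain ⟨δ, hδ, hδU⟩ := Metric.eventually_nhds_iff.mp hU
  refine ⟨min ε δ, lt_min hε hδ, fun t => (α t).1, fun t => (α t).2, by simp [hα0], by simp [hα0],
    fun t ht => ⟨hδU ?_, ?_, ?_⟩⟩
  · rw [Real.dist_0_eq_abs, abs_lt]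
    exact ⟨by linarith [ht.1, min_le_right ε δ], by linarith [ht.2, min_le_right ε δ]⟩
  all_goals
    have hd := hα t ⟨by linarith [ht.1, min_le_left ε δ], by linarith [ht.2, min_le_left ε δ]⟩
  · exact hd.fst
  · exact hd.snd

variable {J : Set ℝ}

/-- Bootstrapping: the equation makes `u'` continuous, so `u` is `C¹` and `x`, having derivative
`u`, is `C²`. -/
theorem contDiffOn_of_geodesic (h : IsImmersionOn φ U) (hJ : IsOpen J)
    (hg : ∀ t ∈ J, x t ∈ U ∧ HasDerivAt x (u t) t ∧
      HasDerivAt u (-christoffelQuadratic (firstFundamentalForm φ) (x t) (u t)) t) :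
    ContDiffOn ℝ 2 x J := by
  have hu : ContDiffOn ℝ 1 u J := by
    rw [show (1 : WithTop ℕ∞) = 0 + 1 by simp, contDiffOn_succ_iff_deriv_of_isOpen hJ]
    refine ⟨fun t ht => (hg t ht).2.2.differentiableAt.differentiableWithinAt, by simp, ?_⟩
    rw [contDiffOn_zero]
    refine ContinuousOn.congr (f := fun t =>
      -christoffelQuadratic (firstFundamentalForm φ) (x t) (u t)) (fun t ht => ?_)
      fun t ht => (hg t ht).2.2.deriv
    obtain ⟨hxU, hx, hu⟩ := hg t ht
    refine (ContinuousAt.neg ?_).continuousWithinAt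
    exact ContinuousAt.comp (f := fun s => (x s, u s))
      (h.contDiffAt_christoffelQuadratic (z := (x t, u t)) hxU).continuousAt
      (hx.continuousAt.prodMk hu.continuousAt)
  rw [show (2 : WithTop ℕ∞) = 1 + 1 by norm_num, contDiffOn_succ_iff_deriv_of_isOpen hJ]
  exact ⟨fun t ht => (hg t ht).2.1.differentiableAt.differentiableWithinAt, by simp,
    hu.congr fun t ht => (hg t ht).2.1.deriv⟩

/-- The acceleration is normal and the velocity tangent, so the squared speed has derivative zero.
-/
theorem norm_velocity_eq (h : IsImmersionOn φ U) (hJ : IsOpen J) (hJc : J.OrdConnected)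
    (hg : ∀ t ∈ J, x t ∈ U ∧ HasDerivAt x (u t) t ∧
      HasDerivAt u (-christoffelQuadratic (firstFundamentalForm φ) (x t) (u t)) t)
    {s t : ℝ} (hs : s ∈ J) (ht : t ∈ J) :
    ‖fderiv ℝ φ (x s) (u s)‖ = ‖fderiv ℝ φ (x t) (u t)‖ := by
  have hd : ∀ t ∈ J, HasDerivAt (fun s => ‖fderiv ℝ φ (x s) (u s)‖ ^ 2) 0 t := by
    intro t ht
    obtain ⟨hxU, hx, hu⟩ := hg t ht
    have := (h.hasDerivAt_fderiv_comp hxU hx hu).norm_sq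
    simpa [real_inner_comm, h.inner_secondFundamentalForm_fderiv hxU] using this
  have := hJ.is_const_of_deriv_eq_zero hJc.isPreconnected
    (fun t ht => (hd t ht).differentiableAt.differentiableWithinAt)
    (fun t ht => (hd t ht).deriv) hs ht
  exact (sq_eq_sq₀ (norm_nonneg _) (norm_nonneg _)).mp this

end IsImmersionOn

end Curves

/-! ### Geodesics of the manifold and their ambient curvature -/

section Immersions

variable {m N : ℕ} {M : Type*} [TopologicalSpace M] [ChartedSpace (EuclideanSpace ℝ (Fin m)) M] {f : M → EuclideanSpace ℝ (Fin N)}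

variable (m f) in
/-- The immersion `f` read in the preferred chart at `p`. -/
abbrev chartReading (p : M) : EuclideanSpace ℝ (Fin m) → EuclideanSpace ℝ (Fin N) :=
  f ∘ (extChartAt (𝓡 m) p).symm

theorem IsUnitSpeedGeodesicOn.mono {γ : ℝ → M} {J K : Set ℝ}
    (h : IsUnitSpeedGeodesicOn m f γ J) (hK : K ⊆ J) : IsUnitSpeedGeodesicOn m f γ K :=
  ⟨h.contMDiffOn.mono hK, fun t ht => h.geodesic_eq t (hK ht), fun t ht => h.unit_speed t (hK ht)⟩

theorem CongruentOn.norm_deriv_deriv_eq {r q : ℝ → EuclideanSpace ℝ (Fin N)} {J : Set ℝ}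
    (h : CongruentOn r q J) {t : ℝ} (ht : J ∈ nhds t) :
    ‖deriv (deriv r) t‖ = ‖deriv (deriv q) t‖ := by
  obtain ⟨U, hU⟩ := h
  have hr : r =ᶠ[nhds t] fun s => U.linearIsometryEquiv (q s) + U 0 := by
    filter_upwards [ht] with s hs
    rw [hU s hs]
    simpa using U.map_vadd 0 (q s)
  -- Differentiability of `w` is not needed: composition with a continuous linear equivalence always
  -- commutes with `fderiv`, junk values included.
  have hd : ∀ (w : ℝ → EuclideanSpace ℝ (Fin N)) (s : ℝ),
      deriv (fun s => U.linearIsometryEquiv (w s)) s = U.linearIsometryEquiv (deriv w s) :=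
    fun w s => by
      have h1 := U.linearIsometryEquiv.toContinuousLinearEquiv.comp_fderiv (f := w) (x := s)
      exact congrArg (fun l : ℝ →L[ℝ] EuclideanSpace ℝ (Fin N) => l 1) h1
  have hr1 : deriv r =ᶠ[nhds t] fun s => U.linearIsometryEquiv (deriv q s) := by
    filter_upwards [hr.deriv] with s hs
    rw [hs, deriv_add_const, hd]
  rw [hr1.deriv_eq, hd, LinearIsometryEquiv.norm_map]

variable [IsManifold (𝓡 m) ∞ M]

theorem contMDiffAt_extChartAt_symm (p : M) {y : EuclideanSpace ℝ (Fin m)}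
    (hy : y ∈ (extChartAt (𝓡 m) p).target) :
    ContMDiffAt 𝓘(ℝ, EuclideanSpace ℝ (Fin m)) (𝓡 m) ∞ (extChartAt (𝓡 m) p).symm y :=
  (contMDiffOn_extChartAt_symm p).contMDiffAt (extChartAt_target_mem_nhds' hy)

theorem IsSmoothImmersion.isImmersionOn (hf : IsSmoothImmersion m f) (p : M) :
    IsImmersionOn (chartReading m f p) (extChartAt (𝓡 m) p).target where
  isOpen := isOpen_extChartAt_target p
  contDiffAt y hy := contMDiffAt_iff_contDiffAt.mp
    ((hf.1 _).comp y (contMDiffAt_extChartAt_symm p hy))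
  injective y hy := by
    have h1 : fderiv ℝ (chartReading m f p) y =
        (mfderiv (𝓡 m) 𝓘(ℝ, EuclideanSpace ℝ (Fin N)) f ((extChartAt (𝓡 m) p).symm y)).comp
          (mfderiv 𝓘(ℝ, EuclideanSpace ℝ (Fin m)) (𝓡 m) (extChartAt (𝓡 m) p).symm y) := by
      rw [← mfderiv_eq_fderiv]
      exact mfderiv_comp y ((hf.1 _).mdifferentiableAt (by simp))
        ((contMDiffAt_extChartAt_symm p hy).mdifferentiableAt (by simp))
    have h2 := isInvertible_mfderivWithin_extChartAt_symm hy
    rw [ModelWithCorners.range_eq_univ, mfderivWithin_univ] at h2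
    rw [h1]
    exact (hf.2 _).comp h2.injective

/-- The change of charts relates the differentials of the chart readings. -/
theorem IsSmoothImmersion.exists_fderiv_chartReading_eq (hf : IsSmoothImmersion m f) (p q : M)
    {y : M} (hp : y ∈ (extChartAt (𝓡 m) p).source) (hq : y ∈ (extChartAt (𝓡 m) q).source)
    (b : EuclideanSpace ℝ (Fin m)) :
    ∃ c, fderiv ℝ (chartReading m f q) (extChartAt (𝓡 m) q y) b =
      fderiv ℝ (chartReading m f p) (extChartAt (𝓡 m) p y) c := by
  set z := extChartAt (𝓡 m) q y with hz
  have hzt : z ∈ (extChartAt (𝓡 m) q).target := (extChartAt (𝓡 m) q).map_source hq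
  have hzy : (extChartAt (𝓡 m) q).symm z = y := (extChartAt (𝓡 m) q).left_inv hq
  set τ := extChartAt (𝓡 m) p ∘ (extChartAt (𝓡 m) q).symm with hτ
  have hτz : τ z = extChartAt (𝓡 m) p y := congrArg (extChartAt (𝓡 m) p) hzy
  have hτd : DifferentiableAt ℝ τ z := by
    have h1 : ContMDiffAt (𝓡 m) 𝓘(ℝ, EuclideanSpace ℝ (Fin m)) ∞ (extChartAt (𝓡 m) p)
        ((extChartAt (𝓡 m) q).symm z) := by
      rw [hzy]
      exact contMDiffAt_extChartAt' (by rwa [← extChartAt_source (𝓡 m)])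
    exact (contMDiffAt_iff_contDiffAt.mp
      (h1.comp z (contMDiffAt_extChartAt_symm q hzt))).differentiableAt (by simp)
  have hev : chartReading m f q =ᶠ[nhds z] chartReading m f p ∘ τ := by
    have h1 : (extChartAt (𝓡 m) q).symm ⁻¹' (extChartAt (𝓡 m) p).source ∈ nhds z := by
      refine (continuousAt_extChartAt_symm'' hzt).preimage_mem_nhds ?_
      rw [hzy]
      exact extChartAt_source_mem_nhds' hp
    filter_upwards [h1] with w hw
    simp only [hτ, chartReading, Function.comp_apply]
    rw [(extChartAt (𝓡 m) p).left_inv hw]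
  have hφ : DifferentiableAt ℝ (chartReading m f p) (τ z) := by
    rw [hτz]
    exact ((hf.isImmersionOn p).contDiffAt _
      ((extChartAt (𝓡 m) p).map_source hp)).differentiableAt (by simp)
  refine ⟨fderiv ℝ τ z b, ?_⟩
  rw [hev.fderiv_eq, fderiv_comp z hφ hτd, hτz]
  rfl

/-- A curve in `ℝᵐ` solving the geodesic equation in the chart at `p` is a geodesic of `M`. -/
theorem IsSmoothImmersion.isUnitSpeedGeodesicOn (hf : IsSmoothImmersion m f) (p : M)
    {x u : ℝ → EuclideanSpace ℝ (Fin m)} {J : Set ℝ} (hJ : IsOpen J)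
    (hg : ∀ t ∈ J, x t ∈ (extChartAt (𝓡 m) p).target ∧ HasDerivAt x (u t) t ∧
      HasDerivAt u
        (-christoffelQuadratic (firstFundamentalForm (chartReading m f p)) (x t) (u t)) t)
    (hunit : ∀ t ∈ J, ‖fderiv ℝ (chartReading m f p) (x t) (u t)‖ = 1) :
    IsUnitSpeedGeodesicOn m f ((extChartAt (𝓡 m) p).symm ∘ x) J := by
  have himm := hf.isImmersionOn p
  have hγ : ContMDiffOn 𝓘(ℝ, ℝ) (𝓡 m) 2 ((extChartAt (𝓡 m) p).symm ∘ x) J :=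
    ((contMDiffOn_extChartAt_symm (n := ∞) p).of_le ENat.LEInfty.out).comp
      (himm.contDiffOn_of_geodesic hJ hg).contMDiffOn fun t ht => (hg t ht).1
  have hcomp : f ∘ ((extChartAt (𝓡 m) p).symm ∘ x) = chartReading m f p ∘ x := rfl
  refine ⟨hγ, fun t ht => ?_, fun t ht => ?_⟩
  -- The equation is required in the chart at `γ t`, while `x` solves it in the chart at `p`.
  -- Instead of transforming Christoffel symbols, the ambient acceleration, which is independent of
  -- charts, is computed in both.
  · set γ := (extChartAt (𝓡 m) p).symm ∘ x with hγdef
    set q := γ t with hq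
    set z := fun s => extChartAt (𝓡 m) q (γ s) with hz
    have hqs : γ t ∈ (extChartAt (𝓡 m) q).source := mem_extChartAt_source q
    have hγt : ContMDiffAt 𝓘(ℝ, ℝ) (𝓡 m) 2 γ t := hγ.contMDiffAt (hJ.mem_nhds ht)
    have hzC : ContDiffAt ℝ 2 z t := contMDiffAt_iff_contDiffAt.mp
      ((contMDiffAt_extChartAt' (n := 2) (x := q) (mem_chart_source _ q)).comp t hγt)
    have hz1 : ∀ᶠ s in nhds t, HasDerivAt z (deriv z s) s := by
      filter_upwards [hzC.eventually (by simp)] with s hs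
      exact (hs.differentiableAt (by simp)).hasDerivAt
    have hz2 : HasDerivAt (deriv z) (deriv (deriv z) t) t := by
      have h1 : ContDiffAt ℝ 1 (deriv z) t := (hzC.fderiv_right (m := 1) (by norm_num)).clm_apply contDiffAt_const
      exact (h1.differentiableAt (by simp)).hasDerivAt
    have hzU : z t ∈ (extChartAt (𝓡 m) q).target := (extChartAt (𝓡 m) q).map_source hqs
    have hev : f ∘ γ =ᶠ[nhds t] chartReading m f q ∘ z := by
      filter_upwards [hγt.continuousAt.preimage_mem_nhds (extChartAt_source_mem_nhds' hqs)]
        with s hs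
      simp only [hz, chartReading, Function.comp_apply]
      rw [(extChartAt (𝓡 m) q).left_inv hs]
    have hacc := (hf.isImmersionOn q).deriv_deriv_comp hzU hz1 hz2
    rw [← hev.deriv.deriv_eq, hcomp, himm.deriv_deriv_comp (hg t ht).1
      (by filter_upwards [hJ.mem_nhds ht] with s hs using (hg s hs).2.1) (hg t ht).2.2,
      neg_add_cancel, map_zero, add_zero] at hacc
    set b := deriv (deriv z) t +
      christoffelQuadratic (firstFundamentalForm (chartReading m f q)) (z t) (deriv z t) with hb
    have hps : γ t ∈ (extChartAt (𝓡 m) p).source := (extChartAt (𝓡 m) p).map_target (hg t ht).1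
    obtain ⟨c, hc⟩ := hf.exists_fderiv_chartReading_eq p q hps hqs b
    have hxt : extChartAt (𝓡 m) p (γ t) = x t := (extChartAt (𝓡 m) p).right_inv (hg t ht).1
    rw [hxt] at hc
    -- Pair the acceleration with the tangent vector `dφ_q(b) = dφ_p(c)`: the chart at `q` gives its
    -- squared length, the chart at `p` gives zero.
    have hb0 : b = 0 := by
      refine (hf.isImmersionOn q).injective _ hzU ?_
      rw [map_zero, ← inner_self_eq_zero (𝕜 := ℝ)]
      have h1 := congrArg (fun e => inner ℝ e (fderiv ℝ (chartReading m f q) (z t) b)) hacc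
      simp only [inner_add_left, (hf.isImmersionOn q).inner_secondFundamentalForm_fderiv hzU,
        zero_add] at h1
      rw [← h1]
      exact (congrArg _ hc).trans
        (himm.inner_secondFundamentalForm_fderiv (hg t ht).1 (u t) (u t) c)
    intro k
    have hz1k : ∀ i, ∀ᶠ s in nhds t, deriv (fun s => z s i) s = deriv z s i := fun i => by
      filter_upwards [hz1] with s hs
      exact ((EuclideanSpace.proj (𝕜 := ℝ) i).hasFDerivAt.comp_hasDerivAt s hs).deriv
    have hz2k : deriv (deriv fun s => z s k) t = deriv (deriv z) t k := by
      rw [Filter.EventuallyEq.deriv_eq (hz1k k)]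
      exact ((EuclideanSpace.proj (𝕜 := ℝ) k).hasFDerivAt.comp_hasDerivAt t hz2).deriv
    have hbk := congrArg (fun e : EuclideanSpace ℝ (Fin m) => e k) hb0
    -- `inducedMetric` is definitionally the first fundamental form of the chart reading.
    change deriv (deriv fun s => z s k) t + ∑ i, ∑ j,
      christoffel (firstFundamentalForm (chartReading m f q)) k i j (z t) *
        deriv (fun s => z s i) t * deriv (fun s => z s j) t = 0
    rw [hz2k]
    simp only [fun i => (hz1k i).self_of_nhds]
    exact hbk
  · rw [hcomp, (himm.hasDerivAt_comp (hg t ht).1 (hg t ht).2.1).deriv]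
    exact hunit t ht

/-- Local existence of geodesics. -/
theorem IsSmoothImmersion.exists_isUnitSpeedGeodesicOn (hf : IsSmoothImmersion m f) (p : M)
    {v : EuclideanSpace ℝ (Fin m)}
    (hv : ‖fderiv ℝ (chartReading m f p) (extChartAt (𝓡 m) p p) v‖ = 1) :
    ∃ ε > (0 : ℝ), ∃ γ : ℝ → M, IsUnitSpeedGeodesicOn m f γ (Set.Ioo (-ε) ε) ∧
      deriv (deriv (f ∘ γ)) 0 =
        secondFundamentalForm (chartReading m f p) (extChartAt (𝓡 m) p p) v v := by
  have himm := hf.isImmersionOn p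
  obtain ⟨ε, hε, x, u, hx0, hu0, hg⟩ := himm.exists_geodesic (mem_extChartAt_target p) v
  have h0 : (0 : ℝ) ∈ Set.Ioo (-ε) ε := by simpa using hε
  refine ⟨ε, hε, _, hf.isUnitSpeedGeodesicOn p isOpen_Ioo hg fun t ht => ?_, ?_⟩
  · rw [himm.norm_velocity_eq isOpen_Ioo Set.ordConnected_Ioo hg ht h0, hx0, hu0, hv]
  · change deriv (deriv (chartReading m f p ∘ x)) 0 = _
    rw [himm.deriv_deriv_comp (hg 0 h0).1
      (by filter_upwards [isOpen_Ioo.mem_nhds h0] with s hs using (hg s hs).2.1) (hg 0 h0).2.2,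
      neg_add_cancel, map_zero, add_zero, hx0, hu0]

/-- All geodesics have the same curvature in the ambient space. -/
theorem AllGeodesicsCongruentScrewLines.exists_norm_secondFundamentalForm_eq
    (hf : IsSmoothImmersion m f) (hgeod : AllGeodesicsCongruentScrewLines m f) :
    ∃ κ : ℝ, ∀ (p : M) (v : EuclideanSpace ℝ (Fin m)),
      ‖fderiv ℝ (chartReading m f p) (extChartAt (𝓡 m) p p) v‖ = 1 →
      ‖secondFundamentalForm (chartReading m f p) (extChartAt (𝓡 m) p p) v v‖ ^ 2 = κ := by
  by_cases hex : ∃ (p : M) (v : EuclideanSpace ℝ (Fin m)),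
      ‖fderiv ℝ (chartReading m f p) (extChartAt (𝓡 m) p p) v‖ = 1
  · obtain ⟨p₀, v₀, hv₀⟩ := hex
    refine ⟨‖secondFundamentalForm (chartReading m f p₀) (extChartAt (𝓡 m) p₀ p₀) v₀ v₀‖ ^ 2,
      fun p v hv => ?_⟩
    obtain ⟨ε, hε, γ, hγ, hγ2⟩ := hf.exists_isUnitSpeedGeodesicOn p hv
    obtain ⟨δ, hδ, σ, hσ, hσ2⟩ := hf.exists_isUnitSpeedGeodesicOn p₀ hv₀
    have hεm := min_le_left ε δ
    have hδm := min_le_right ε δ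
    -- Congruence concerns geodesics on the same interval, so both are restricted to the shorter
    -- one.
    have h := hgeod.2 (Set.Ioo (-min ε δ) (min ε δ)) γ σ isOpen_Ioo Set.ordConnected_Ioo
      (hγ.mono (Set.Ioo_subset_Ioo (neg_le_neg hεm) hεm))
      (hσ.mono (Set.Ioo_subset_Ioo (neg_le_neg hδm) hδm))
    rw [← hγ2, ← hσ2, h.norm_deriv_deriv_eq (isOpen_Ioo.mem_nhds (by simpa using ⟨hε, hδ⟩))]
  -- Without unit tangent vectors (`M` empty or `m = 0`) any constant serves.
  · exact ⟨0, fun p v hv => absurd ⟨p, v, hv⟩ hex⟩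

end Immersions

/-! ### Polarization, and spherical immersions of codimension at most two -/

section Hypersurfaces

variable {m : ℕ} {F : Type*} [NormedAddCommGroup F] [InnerProductSpace ℝ F]

/-- Polarization of `‖β(v, v)‖² = c |v|⁴` for a quadratic form `β` with values in a line. -/
theorem inner_sub_norm_sq_of_norm_sq_quadratic {A B D : F} {a b d c : ℝ} (ha : 0 < a)
    (h : ∀ t : ℝ, ‖A + (2 * t) • B + t ^ 2 • D‖ ^ 2 = c * (a + 2 * t * b + t ^ 2 * d) ^ 2)
    (hcol : inner ℝ A B ^ 2 = ‖A‖ ^ 2 * ‖B‖ ^ 2) :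
    inner ℝ A D - ‖B‖ ^ 2 = c * (a * d - b ^ 2) := by
  have hexp : ∀ t : ℝ, ‖A + (2 * t) • B + t ^ 2 • D‖ ^ 2 = ‖A‖ ^ 2 + 4 * t * inner ℝ A B
      + t ^ 2 * (4 * ‖B‖ ^ 2 + 2 * inner ℝ A D) + 4 * t ^ 3 * inner ℝ B D + t ^ 4 * ‖D‖ ^ 2 := by
    intro t
    simp only [← real_inner_self_eq_norm_sq, inner_add_left, inner_add_right, inner_smul_left,
      inner_smul_right, conj_trivial, real_inner_comm A B, real_inner_comm A D,
      real_inner_comm B D]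
    ring
  simp only [hexp] at h
  -- Both sides are quartic in `t`, so the values at `0, ±1, ±2` determine the coefficients; those
  -- of `1`, `t` and `t²` are extracted below.
  have h0 := h 0
  have h1 := h 1
  have h2 := h (-1)
  have h3 := h 2
  have h4 := h (-2)
  have hA : ‖A‖ ^ 2 = c * a ^ 2 := by linear_combination h0
  have hAB : inner ℝ A B = c * a * b := by
    linear_combination (1 / 6) * (h1 - h2) - (1 / 48) * (h3 - h4)
  have hAD : 4 * ‖B‖ ^ 2 + 2 * inner ℝ A D = c * (4 * b ^ 2 + 2 * a * d) := by
    linear_combination (2 / 3) * (h1 + h2) - (1 / 24) * (h3 + h4) - (5 / 4) * h0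
  -- Collinearity gives `‖B‖²` after division by `‖A‖² = c a²`; when `c = 0`, `A` vanishes and the
  -- `t²` coefficient gives `B = 0`.
  have hB : ‖B‖ ^ 2 = c * b ^ 2 := by
    rcases eq_or_ne c 0 with rfl | hc
    · have hA0 : A = 0 := by simpa using hA
      subst hA0
      simp only [inner_zero_left] at hAD
      linarith
    · rw [hA, hAB] at hcol
      have : c * a ^ 2 ≠ 0 := mul_ne_zero hc (pow_ne_zero 2 ha.ne')
      refine mul_left_cancel₀ this ?_
      linear_combination -hcol
  linear_combination hAD / 2 - 3 * hB

theorem secondFundamentalForm_add_left (φ : EuclideanSpace ℝ (Fin m) → F)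
    (y v v' w : EuclideanSpace ℝ (Fin m)) :
    secondFundamentalForm φ y (v + v') w =
      secondFundamentalForm φ y v w + secondFundamentalForm φ y v' w := by
  simp [secondFundamentalForm, add_mul, add_smul, Finset.sum_add_distrib]

theorem secondFundamentalForm_smul_left (φ : EuclideanSpace ℝ (Fin m) → F)
    (y v w : EuclideanSpace ℝ (Fin m)) (t : ℝ) :
    secondFundamentalForm φ y (t • v) w = t • secondFundamentalForm φ y v w := by
  simp [secondFundamentalForm, Finset.smul_sum, smul_smul, mul_assoc]

namespace IsImmersionOn

variable {φ : EuclideanSpace ℝ (Fin m) → F} {U : Set (EuclideanSpace ℝ (Fin m))}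
  {y : EuclideanSpace ℝ (Fin m)}

theorem secondFundamentalForm_add_smul (h : IsImmersionOn φ U) (hy : y ∈ U)
    (v w : EuclideanSpace ℝ (Fin m)) (t : ℝ) :
    secondFundamentalForm φ y (v + t • w) (v + t • w) =
      secondFundamentalForm φ y v v + (2 * t) • secondFundamentalForm φ y v w
        + t ^ 2 • secondFundamentalForm φ y w w := by
  have hc := h.secondFundamentalForm_comm hy
  rw [secondFundamentalForm_add_left, secondFundamentalForm_smul_left, hc v (v + t • w),
    hc w (v + t • w), secondFundamentalForm_add_left, secondFundamentalForm_add_left,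
    secondFundamentalForm_smul_left, secondFundamentalForm_smul_left, hc w v]
  module

section Sphere

theorem inner_vecPartialDeriv_of_sphere (h : IsImmersionOn φ U) (hs : ∀ z ∈ U, ‖φ z‖ = 1)
    (hy : y ∈ U) (i : Fin m) : inner ℝ (φ y) (vecPartialDeriv i φ y) = 0 := by
  have hev : (fun z => inner ℝ (φ z) (φ z)) =ᶠ[nhds y] fun _ => (1 : ℝ) := by
    filter_upwards [h.isOpen.mem_nhds hy] with z hz
    rw [real_inner_self_eq_norm_sq, hs z hz, one_pow]
  have h1 := partialDeriv_inner (h.contDiffAt y hy) (h.contDiffAt y hy) i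
  rw [partialDeriv, hev.fderiv_eq, real_inner_comm (φ y) (vecPartialDeriv i φ y)] at h1
  simp only [fderiv_fun_const, Pi.zero_apply, zero_apply] at h1
  linarith

theorem inner_fderiv_of_sphere (h : IsImmersionOn φ U) (hs : ∀ z ∈ U, ‖φ z‖ = 1)
    (hy : y ∈ U) (v : EuclideanSpace ℝ (Fin m)) : inner ℝ (φ y) (fderiv ℝ φ y v) = 0 := by
  rw [fderiv_eq_sum_vecPartialDeriv, inner_sum]
  simp [inner_smul_right, h.inner_vecPartialDeriv_of_sphere hs hy]

/-- Differentiate `⟨φ, ∂ⱼφ⟩ = 0` once more. This isolates the contribution of the sphere itself to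
the second fundamental form. -/
theorem inner_secondFundamentalForm_of_sphere (h : IsImmersionOn φ U) (hs : ∀ z ∈ U, ‖φ z‖ = 1)
    (hy : y ∈ U) (v w : EuclideanSpace ℝ (Fin m)) :
    inner ℝ (secondFundamentalForm φ y v w) (φ y) =
      -inner ℝ (fderiv ℝ φ y v) (fderiv ℝ φ y w) := by
  have hcoeff : ∀ i j, inner ℝ (secondFundamentalCoeff φ i j y) (φ y) =
      -inner ℝ (vecPartialDeriv i φ y) (vecPartialDeriv j φ y) := by
    intro i j
    have hev : (fun z => inner ℝ (φ z) (vecPartialDeriv j φ z)) =ᶠ[nhds y] fun _ => (0 : ℝ) := by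
      filter_upwards [h.isOpen.mem_nhds hy] with z hz
      exact h.inner_vecPartialDeriv_of_sphere hs hz j
    have h1 := partialDeriv_inner (h.contDiffAt y hy) (h.contDiffAt_vecPartialDeriv hy j) i
    rw [partialDeriv, hev.fderiv_eq] at h1
    simp only [fderiv_fun_const, Pi.zero_apply, zero_apply] at h1
    rw [secondFundamentalCoeff, inner_sub_left, sum_inner]
    simp only [inner_smul_right, real_inner_comm (φ y), h.inner_vecPartialDeriv_of_sphere hs hy,
      mul_zero, Finset.sum_const_zero, sub_zero]
    linarith
  rw [fderiv_eq_sum_vecPartialDeriv, fderiv_eq_sum_vecPartialDeriv, secondFundamentalForm]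
  simp only [sum_inner, inner_sum, inner_smul_left, inner_smul_right, hcoeff, conj_trivial,
    Finset.mul_sum, ← Finset.sum_neg_distrib]
  rw [Finset.sum_comm]
  exact Finset.sum_congr rfl fun _ _ => Finset.sum_congr rfl fun _ _ => by ring

/-- In codimension at most one in the sphere, vectors normal to the immersion and tangent to the
sphere are parallel. -/
theorem inner_sq_eq_of_normal [FiniteDimensional ℝ F] (h : IsImmersionOn φ U)
    (hs : ∀ z ∈ U, ‖φ z‖ = 1) (hy : y ∈ U) (hdim : Module.finrank ℝ F ≤ m + 2) {a b : F}
    (ha : ∀ v, inner ℝ (fderiv ℝ φ y v) a = 0) (ha' : inner ℝ (φ y) a = 0)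
    (hb : ∀ v, inner ℝ (fderiv ℝ φ y v) b = 0) (hb' : inner ℝ (φ y) b = 0) :
    inner ℝ a b ^ 2 = ‖a‖ ^ 2 * ‖b‖ ^ 2 := by
  set T := LinearMap.range (fderiv ℝ φ y : EuclideanSpace ℝ (Fin m) →ₗ[ℝ] F) with hT
  -- Tangent space plus radial line: its dimension is at least `m + 1`, so its orthogonal complement
  -- is at most a line.
  set K := T ⊔ Submodule.span ℝ {φ y} with hK
  have hmem : ∀ c : F, (∀ v, inner ℝ (fderiv ℝ φ y v) c = 0) → inner ℝ (φ y) c = 0 → c ∈ Kᗮ := by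
    intro c hc hc'
    rw [hK, ← Submodule.inf_orthogonal, Submodule.mem_inf]
    refine ⟨?_, Submodule.mem_orthogonal_singleton_iff_inner_right.mpr hc'⟩
    rw [Submodule.mem_orthogonal]
    rintro _ ⟨v, rfl⟩
    exact hc v
  have hTdim : Module.finrank ℝ T = m := by
    rw [hT, LinearMap.finrank_range_of_inj (h.injective y hy), finrank_euclideanSpace_fin]
  have hφT : φ y ∉ T := by
    rintro ⟨v, hv⟩
    have h1 := h.inner_fderiv_of_sphere hs hy v
    rw [show fderiv ℝ φ y v = φ y from hv, real_inner_self_eq_norm_sq, hs y hy] at h1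
    norm_num at h1
  have hlt : T < K := by
    refine lt_of_le_of_ne le_sup_left fun he => hφT ?_
    rw [he]
    exact Submodule.mem_sup_right (Submodule.mem_span_singleton_self _)
  have hKdim := Submodule.finrank_lt_finrank_of_lt hlt
  have hperp := K.finrank_add_finrank_orthogonal
  obtain ⟨e, he⟩ := finrank_le_one_iff.mp (show Module.finrank ℝ Kᗮ ≤ 1 by omega)
  obtain ⟨r, hr⟩ := he ⟨a, hmem a ha ha'⟩
  obtain ⟨s, hs⟩ := he ⟨b, hmem b hb hb'⟩
  have hr' : a = r • (e : F) := (congrArg Subtype.val hr).symm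
  have hs' : b = s • (e : F) := (congrArg Subtype.val hs).symm
  rw [hr', hs']
  simp only [← real_inner_self_eq_norm_sq, inner_smul_left, inner_smul_right, conj_trivial]
  ring

/-- If all normal curvatures of a spherical immersion of codimension at most two agree at a point,
then so do all sectional curvatures. -/
theorem coordSectionalCurvature_eq_of_norm_secondFundamentalForm [FiniteDimensional ℝ F]
    (h : IsImmersionOn φ U) (hs : ∀ z ∈ U, ‖φ z‖ = 1) (hy : y ∈ U)
    (hdim : Module.finrank ℝ F ≤ m + 2) {κ : ℝ}
    (hκ : ∀ v, ‖fderiv ℝ φ y v‖ = 1 → ‖secondFundamentalForm φ y v v‖ ^ 2 = κ)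
    {v w : EuclideanSpace ℝ (Fin m)} (hvw : LinearIndependent ℝ ![v, w]) :
    coordSectionalCurvature (firstFundamentalForm φ) y v w = κ := by
  have hinj := h.injective y hy
  -- Extension from unit vectors by homogeneity of degree four.
  have hκ' : ∀ u, ‖secondFundamentalForm φ y u u‖ ^ 2 = κ * (‖fderiv ℝ φ y u‖ ^ 2) ^ 2 := by
    intro u
    rcases eq_or_ne u 0 with rfl | hu
    · simp [secondFundamentalForm]
    have hn : ‖fderiv ℝ φ y u‖ ≠ 0 := by
      rw [norm_ne_zero_iff]
      exact fun h0 => hu (hinj (h0.trans (map_zero _).symm))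
    have h1 := hκ (‖fderiv ℝ φ y u‖⁻¹ • u) (by
      rw [map_smul, norm_smul, norm_inv, norm_norm, inv_mul_cancel₀ hn])
    rw [secondFundamentalForm_smul_left, h.secondFundamentalForm_comm hy,
      secondFundamentalForm_smul_left, norm_smul, norm_smul, norm_inv, norm_norm] at h1
    rw [← h1]
    field_simp
  -- The second fundamental form in the sphere: the radial component is removed.
  set β : EuclideanSpace ℝ (Fin m) → EuclideanSpace ℝ (Fin m) → F := fun a b =>
    secondFundamentalForm φ y a b + (inner ℝ (fderiv ℝ φ y a) (fderiv ℝ φ y b) : ℝ) • φ y with hβ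
  have hφ1 : inner ℝ (φ y) (φ y) = (1 : ℝ) := by
    rw [real_inner_self_eq_norm_sq, hs y hy, one_pow]
  have hα := h.inner_secondFundamentalForm_of_sphere hs hy
  have hα' : ∀ a b, inner ℝ (φ y) (secondFundamentalForm φ y a b) =
      -inner ℝ (fderiv ℝ φ y a) (fderiv ℝ φ y b) := fun a b => by rw [real_inner_comm, hα]
  have hβinner : ∀ a b c d, inner ℝ (β a b) (β c d) =
      inner ℝ (secondFundamentalForm φ y a b) (secondFundamentalForm φ y c d)
        - inner ℝ (fderiv ℝ φ y a) (fderiv ℝ φ y b)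
          * inner ℝ (fderiv ℝ φ y c) (fderiv ℝ φ y d) := by
    intro a b c d
    simp only [hβ, inner_add_left, inner_add_right, inner_smul_left, inner_smul_right,
      conj_trivial, hα, hα', hφ1]
    ring
  have hβφ : ∀ a b, inner ℝ (φ y) (β a b) = 0 := by
    intro a b
    simp only [hβ, inner_add_right, inner_smul_right, hα', hφ1]
    ring
  have hβT : ∀ a b u, inner ℝ (fderiv ℝ φ y u) (β a b) = 0 := by
    intro a b u
    simp only [hβ, inner_add_right, inner_smul_right]
    rw [real_inner_comm, h.inner_secondFundamentalForm_fderiv hy, real_inner_comm (φ y),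
      h.inner_fderiv_of_sphere hs hy]
    simp
  have hcol := h.inner_sq_eq_of_normal hs hy hdim (hβT v v) (hβφ v v) (hβT v w) (hβφ v w)
  have hv : 0 < ‖fderiv ℝ φ y v‖ ^ 2 := by
    have : v ≠ 0 := hvw.ne_zero 0
    refine pow_pos (norm_pos_iff.mpr fun h0 => this (hinj (h0.trans (map_zero _).symm))) 2
  have hpoly : ∀ t : ℝ, ‖β v v + (2 * t) • β v w + t ^ 2 • β w w‖ ^ 2 =
      (κ - 1) * (‖fderiv ℝ φ y v‖ ^ 2 + 2 * t * inner ℝ (fderiv ℝ φ y v) (fderiv ℝ φ y w)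
        + t ^ 2 * ‖fderiv ℝ φ y w‖ ^ 2) ^ 2 := by
    intro t
    have hg : inner ℝ (fderiv ℝ φ y (v + t • w)) (fderiv ℝ φ y (v + t • w)) =
        ‖fderiv ℝ φ y v‖ ^ 2 + 2 * t * inner ℝ (fderiv ℝ φ y v) (fderiv ℝ φ y w)
        + t ^ 2 * ‖fderiv ℝ φ y w‖ ^ 2 := by
      simp only [map_add, map_smul, inner_add_left, inner_add_right, inner_smul_left,
        inner_smul_right, conj_trivial, ← real_inner_self_eq_norm_sq,
        real_inner_comm (fderiv ℝ φ y v) (fderiv ℝ φ y w)]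
      ring
    have h1 : β v v + (2 * t) • β v w + t ^ 2 • β w w = β (v + t • w) (v + t • w) := by
      simp only [hβ, h.secondFundamentalForm_add_smul hy, hg, real_inner_self_eq_norm_sq]
      module
    rw [h1, ← real_inner_self_eq_norm_sq, hβinner, real_inner_self_eq_norm_sq, hκ',
      ← real_inner_self_eq_norm_sq (fderiv ℝ φ y (v + t • w)), hg]
    ring
  have hmain := inner_sub_norm_sq_of_norm_sq_quadratic hv hpoly hcol
  rw [← real_inner_self_eq_norm_sq (β v w), hβinner, hβinner] at hmain
  have hdet : ‖fderiv ℝ φ y v‖ ^ 2 * ‖fderiv ℝ φ y w‖ ^ 2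
      - inner ℝ (fderiv ℝ φ y v) (fderiv ℝ φ y w) ^ 2 ≠ 0 := by
    intro h0
    set b : ℝ := inner ℝ (fderiv ℝ φ y v) (fderiv ℝ φ y w) with hb
    -- Up to scale this is the part of `w` orthogonal to `v`; its squared length is `|v|²` times the
    -- Gram determinant.
    have h1 : fderiv ℝ φ y (‖fderiv ℝ φ y v‖ ^ 2 • w - b • v) = 0 := by
      rw [← inner_self_eq_zero (𝕜 := ℝ)]
      simp only [map_sub, map_smul, inner_sub_left, inner_sub_right, inner_smul_left,
        inner_smul_right, conj_trivial, real_inner_self_eq_norm_sq,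
        real_inner_comm (fderiv ℝ φ y v) (fderiv ℝ φ y w), ← hb]
      linear_combination ‖fderiv ℝ φ y v‖ ^ 2 * h0
    have h2 := hinj (h1.trans (map_zero _).symm)
    have h3 := LinearIndependent.pair_iff.mp hvw (-b) (‖fderiv ℝ φ y v‖ ^ 2)
      (by rw [← h2]; module)
    exact hv.ne' h3.2
  -- Passing from `β` back to `α` adds one Gram determinant, which turns the factor `κ - 1` into
  -- `κ`.
  rw [h.coordSectionalCurvature_eq hy, div_eq_iff hdet]
  simp only [real_inner_self_eq_norm_sq] at hmain ⊢
  linear_combination hmain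

end Sphere

end IsImmersionOn

end Hypersurfaces

end ScrewGeodesics

end

theorem mainTheorem2 (m n : ℕ) (hcodim : n + 1 = m + 1 ∨ n + 1 = m + 2)
    (M : Type*) [TopologicalSpace M] [ChartedSpace (EuclideanSpace ℝ (Fin m)) M]
    [IsManifold (𝓡 m) ∞ M]
    (f : M → EuclideanSpace ℝ (Fin (n + 1)))
    (hf : ScrewGeodesics.IsSmoothImmersion m f)
    (hsphere : ∀ p : M, f p ∈ Metric.sphere (0 : EuclideanSpace ℝ (Fin (n + 1))) 1)
    (hgeod : ScrewGeodesics.AllGeodesicsCongruentScrewLines m f) :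
    ScrewGeodesics.HasConstantSectionalCurvature m f := by
  obtain ⟨κ, hκ⟩ := hgeod.exists_norm_secondFundamentalForm_eq hf
  refine ⟨κ, fun p v w hvw => ?_⟩
  exact (hf.isImmersionOn p).coordSectionalCurvature_eq_of_norm_secondFundamentalForm
    (fun z _ => by simpa using hsphere ((extChartAt (𝓡 m) p).symm z))
    (mem_extChartAt_target p) (by rw [finrank_euclideanSpace_fin]; omega) (hκ p) hvw
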